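/- Multigraphs are loopless and may have parallel edges. Let $M$ be a multigraph with more than one vertex whose edges are coloured with two colours, and suppose that $M$ is M-closed: whenever $xyz$ is a path in $M$ whose two edges $xy$ and $yz$ have the same colour, $x$ and $z$ are adjacent. Let $G$ be an extension of $M$, that is, a 2-edge-coloured multigraph obtained from $M$ by replacing every vertex $v$ by a nonempty independent set $I_v$ such that, for $u\neq v$, $x\in I_u$, $y\in I_v$ and each colour $c$, the vertices $x,y$ are joined by an edge of colour $c$ in $G$ if and only if $u,v$ are joined by an edge of colour $c$ in $M$. Suppose that (a) $G$ is colour-connected: for any two distinct vertices $u,v$ of $G$ there are two paths from $u$ to $v$, each with colours alternating along it, whose union (the first path followed by the reverse of the second) is an alternating closed walk; and (b) $G$ has an eulerian factor: there are pairwise vertex-disjoint induced subgraphs $G_1,\dots,G_k$ of $G$ with $V(G)=V(G_1)\cup\dots\cup V(G_k)$, each of which is supereulerian. Then $G$ is supereulerian. Here a 2-edge-coloured multigraph is supereulerian if it contains a spanning alternating closed trail, that is, a closed walk with at least one edge that uses no edge more than once, visits every vertex, and has alternating colours, its last and first edge also having different colours. -/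

import Mathlib

/-! A 2-edge-coloured multigraph is a multigraph `G : Graph α β` (parallel edges allowed) together
with a colouring `φ : β → Fin 2` of its edges; only the values of `φ` on `E(G)` matter. -/

namespace TwoEdgeColoured

open scoped Graph

variable {α β γ δ : Type*}

/-- `IsWalk G u p v`: starting at the vertex `u` and following the steps `p` (each step consists of
the edge that is used and the vertex that is reached) one walks in `G` from `u` to `v`. -/
def IsWalk (G : Graph α β) : α → List (β × α) → α → Prop
  | u, [], v => u ∈ V(G) ∧ u = v
  | u, s :: p, v => G.IsLink s.1 u s.2 ∧ IsWalk G s.2 p v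

/-- The sequence of colours of the edges of a walk. -/
def colours (φ : β → Fin 2) (p : List (β × α)) : List (Fin 2) :=
  p.map fun s => φ s.1

/-- Consecutive entries are different. -/
def Alternates (l : List (Fin 2)) : Prop :=
  l.IsChain (· ≠ ·)

/-- Consecutive entries are different, and so are the last and the first one. -/
def AlternatesCyclically (l : List (Fin 2)) : Prop :=
  Alternates l ∧ l.getLast? ≠ l.head?

/-- `p` is an alternating `(u, v)`-path: an alternating walk without repeated vertices. -/
def IsAltPath (G : Graph α β) (φ : β → Fin 2) (u : α) (p : List (β × α)) (v : α) : Prop :=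
  IsWalk G u p v ∧ (u :: p.map Prod.snd).Nodup ∧ Alternates (colours φ p)

/-- `p` is an alternating closed trail through `u`: a closed walk with at least one edge and without
repeated edges, whose colours alternate, also between its last and its first edge. -/
def IsAltClosedTrail (G : Graph α β) (φ : β → Fin 2) (u : α) (p : List (β × α)) : Prop :=
  p ≠ [] ∧ IsWalk G u p u ∧ (p.map Prod.fst).Nodup ∧ AlternatesCyclically (colours φ p)

/-- Any two distinct vertices `u, v` are joined by two alternating `(u, v)`-paths whose union (the
first one followed by the reverse of the second one) is an alternating closed walk. -/
def ColourConnected (G : Graph α β) (φ : β → Fin 2) : Prop :=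
  ∀ u ∈ V(G), ∀ v ∈ V(G), u ≠ v → ∃ p q : List (β × α),
    IsAltPath G φ u p v ∧ IsAltPath G φ u q v ∧
      AlternatesCyclically (colours φ p ++ (colours φ q).reverse)

/-- The graph has a spanning alternating closed trail. -/
def Supereulerian (G : Graph α β) (φ : β → Fin 2) : Prop :=
  ∃ (u : α) (p : List (β × α)), IsAltClosedTrail G φ u p ∧ ∀ v ∈ V(G), v ∈ p.map Prod.snd

/-- Vertex-disjoint induced subgraphs that cover all vertices, each of them supereulerian. -/
def HasEulerianFactor (G : Graph α β) (φ : β → Fin 2) : Prop :=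
  ∃ (k : ℕ) (S : Fin k → Set α),
    (∀ i j, i ≠ j → Disjoint (S i) (S j)) ∧ (⋃ i, S i) = V(G) ∧
      ∀ i, Supereulerian (G.induce (S i)) φ

/-- The ends of every monochromatic path of length two are adjacent. -/
def MClosed (G : Graph α β) (φ : β → Fin 2) : Prop :=
  ∀ (x y z : α) (e f : β), x ≠ y → y ≠ z → x ≠ z →
    G.IsLink e x y → G.IsLink f y z → φ e = φ f → G.Adj x z

/-- `(G, φ)` is an extension of `(M, ψ)`: here `M` has more than one vertex, each vertex `a` of `M`
is replaced by a nonempty independent set `{x ∈ V(G) | π x = a}`, and two vertices in different such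
sets are joined by an edge of colour `c` exactly when the vertices that they replace are. The number
of parallel edges of the same colour is not prescribed. -/
def IsExtension (M : Graph γ δ) (ψ : δ → Fin 2) (G : Graph α β) (φ : β → Fin 2) : Prop :=
  V(M).Nontrivial ∧ ∃ π : α → γ,
    π '' V(G) = V(M) ∧
    (∀ x ∈ V(G), ∀ y ∈ V(G), π x = π y → ¬ G.Adj x y) ∧
    ∀ x ∈ V(G), ∀ y ∈ V(G), π x ≠ π y → ∀ c : Fin 2,
      (∃ e, G.IsLink e x y ∧ φ e = c) ↔ ∃ f, M.IsLink f (π x) (π y) ∧ ψ f = c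

end TwoEdgeColoured

/-! Choose a factor into closed trails with as few members as possible. No alternating closed trail
outside the factor meets two members, for otherwise it could be spliced together with the members
that it meets; nor does one arise from a member by replacing an edge with an alternating walk.
With M-closedness this forces the edges between two members `S` and `T` into a rigid pattern: if
there are any, then one of the two dominates the other, say `S` dominates `T`, which means that each
vertex of `S` is joined to all of `T` by edges of a single colour, and this colour alternates along
`S`. Domination is acyclic and transitive, so by connectivity some member `S` dominates all the
others, each vertex of `S` with the same colour for all of them. An alternating walk that leaves a
vertex of `S` in the other colour then never leaves `S`, so that `S` is the only member. -/

namespace TwoEdgeColoured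

open scoped Graph

variable {α β γ δ : Type*} {G H : Graph α β} {φ : β → Fin 2}

lemma rev_ne_self (c : Fin 2) : c.rev ≠ c := by revert c; decide

lemma eq_rev_of_ne {c d : Fin 2} (h : d ≠ c) : d = c.rev := by revert c d; decide

lemma eq_of_rev_ne {c d : Fin 2} (h : c.rev ≠ d) : d = c := by simpa using eq_rev_of_ne h.symm

lemma alternatesCyclically_iff {l : List (Fin 2)} (hl : l ≠ []) :
    AlternatesCyclically l ↔ ∃ c, Alternates (c.rev :: (l ++ [c])) := by
  obtain ⟨a, l, rfl⟩ := List.exists_cons_of_ne_nil hl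
  have hlast : (a :: l).getLast? = some ((a :: l).getLast hl) := List.getLast?_eq_some_getLast hl
  have hchain (c : Fin 2) : Alternates (c.rev :: (a :: l ++ [c])) ↔
      c.rev ≠ a ∧ Alternates (a :: l) ∧ (a :: l).getLast hl ≠ c := by
    rw [Alternates, List.cons_append, List.isChain_cons_cons, ← List.cons_append,
      List.isChain_append, hlast]
    simp [Alternates]
  simp only [hchain, AlternatesCyclically, hlast, List.head?_cons, ne_eq, Option.some.injEq]
  constructor
  · exact fun ⟨h, h'⟩ => ⟨a, rev_ne_self a, h, h'⟩
  · rintro ⟨c, hc, h, h'⟩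
    exact ⟨h, eq_of_rev_ne hc ▸ h'⟩

/-! ### Alternating walks -/

lemma IsWalk.left_mem {p : List (β × α)} {u v : α} (h : IsWalk G u p v) : u ∈ V(G) := by
  cases p with
  | nil => exact h.1
  | cons s p => exact h.1.left_mem

lemma IsWalk.mem_vertexSet {p : List (β × α)} {u v x : α} (h : IsWalk G u p v)
    (hx : x ∈ p.map Prod.snd) : x ∈ V(G) := by
  induction p generalizing u with
  | nil => cases hx
  | cons s p ih =>
    rcases List.mem_cons.1 hx with rfl | hx
    exacts [h.1.right_mem, ih h.2 hx]

lemma IsWalk.of_le {p : List (β × α)} {u v : α} (hHG : H ≤ G) (h : IsWalk H u p v) :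
    IsWalk G u p v := by
  induction p generalizing u with
  | nil => exact ⟨hHG.vertexSet_mono h.1, h.2⟩
  | cons s p ih => exact ⟨h.1.mono hHG, ih h.2⟩

/-- Alternating walks from `u` to `v` whose first edge has colour `c` and which can be continued at
`v` by an edge of colour `d`; so walks can be concatenated when both the vertex and the colour
match. Throughout, `c.rev` is the colour other than `c`. -/
def AltWalk (G : Graph α β) (φ : β → Fin 2) (u : α) (c : Fin 2) (p : List (β × α)) (v : α)
    (d : Fin 2) : Prop :=
  IsWalk G u p v ∧ Alternates (c.rev :: (colours φ p ++ [d]))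

lemma altWalk_nil {u v : α} {c d : Fin 2} :
    AltWalk G φ u c [] v d ↔ u ∈ V(G) ∧ u = v ∧ c = d := by
  have : c.rev ≠ d ↔ c = d := ⟨fun h => (eq_of_rev_ne h).symm, fun h => h ▸ rev_ne_self c⟩
  simp [AltWalk, IsWalk, Alternates, colours, this, and_assoc]

lemma altWalk_cons {s : β × α} {p : List (β × α)} {u v : α} {c d : Fin 2} :
    AltWalk G φ u c (s :: p) v d ↔
      G.IsLink s.1 u s.2 ∧ φ s.1 = c ∧ AltWalk G φ s.2 c.rev p v d := by
  have : c.rev ≠ φ s.1 ↔ φ s.1 = c := ⟨eq_of_rev_ne, fun h => h ▸ rev_ne_self _⟩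
  simp only [AltWalk, IsWalk, Alternates, colours, List.map_cons, List.cons_append,
    List.isChain_cons_cons, this, Fin.rev_rev]
  constructor
  · rintro ⟨⟨hl, hw⟩, rfl, hp⟩
    exact ⟨hl, rfl, hw, hp⟩
  · rintro ⟨hl, rfl, hw, hp⟩
    exact ⟨⟨hl, hw⟩, rfl, hp⟩

lemma altWalk_singleton {s : β × α} {u v : α} {c d : Fin 2} :
    AltWalk G φ u c [s] v d ↔ G.IsLink s.1 u s.2 ∧ φ s.1 = c ∧ s.2 = v ∧ c.rev = d := by
  rw [altWalk_cons, altWalk_nil]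
  exact and_congr_right fun hl => and_congr_right fun _ => and_iff_right hl.right_mem

lemma altWalk_append {p q : List (β × α)} {u w : α} {c d : Fin 2} :
    AltWalk G φ u c (p ++ q) w d ↔ ∃ v b, AltWalk G φ u c p v b ∧ AltWalk G φ v b q w d := by
  induction p generalizing u c with
  | nil =>
    simp only [List.nil_append, altWalk_nil]
    constructor
    · exact fun h => ⟨u, c, ⟨h.1.left_mem, rfl, rfl⟩, h⟩
    · rintro ⟨v, b, ⟨-, rfl, rfl⟩, h⟩
      exact h
  | cons s p ih =>
    simp only [List.cons_append, altWalk_cons, ih]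
    grind

lemma AltWalk.append {p q : List (β × α)} {u v w : α} {b c d : Fin 2}
    (hp : AltWalk G φ u c p v b) (hq : AltWalk G φ v b q w d) : AltWalk G φ u c (p ++ q) w d :=
  altWalk_append.2 ⟨v, b, hp, hq⟩

lemma AltWalk.exists_eq_append_cons {s : β × α} {p : List (β × α)} {u v : α} {c d : Fin 2}
    (h : AltWalk G φ u c p v d) (hs : s ∈ p) :
    ∃ p₁ p₂ x, p = p₁ ++ s :: p₂ ∧ AltWalk G φ u c p₁ x (φ s.1) ∧ G.IsLink s.1 x s.2 ∧
      AltWalk G φ s.2 (φ s.1).rev p₂ v d := by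
  obtain ⟨p₁, p₂, rfl⟩ := List.append_of_mem hs
  obtain ⟨x, b, h₁, h₂⟩ := altWalk_append.1 h
  obtain ⟨hl, rfl, h₂⟩ := altWalk_cons.1 h₂
  exact ⟨p₁, p₂, x, rfl, h₁, hl, h₂⟩

lemma AltWalk.exists_reverse {p : List (β × α)} {u v : α} {c d : Fin 2}
    (h : AltWalk G φ u c p v d) :
    ∃ q, AltWalk G φ v d.rev q u c.rev ∧ q.map Prod.fst = (p.map Prod.fst).reverse ∧
      v :: q.map Prod.snd = (u :: p.map Prod.snd).reverse := by
  induction p generalizing u c with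
  | nil =>
    obtain ⟨hu, rfl, rfl⟩ := altWalk_nil.1 h
    exact ⟨[], altWalk_nil.2 ⟨hu, rfl, rfl⟩, rfl, rfl⟩
  | cons s p ih =>
    obtain ⟨hl, hc, h⟩ := altWalk_cons.1 h
    obtain ⟨q, hq, hfst, hsnd⟩ := ih h
    rw [Fin.rev_rev] at hq
    refine ⟨q ++ [(s.1, u)], hq.append (altWalk_singleton.2 ⟨hl.symm, hc, rfl, rfl⟩), ?_, ?_⟩
    · simp [hfst]
    · rw [List.map_append, ← List.cons_append, hsnd]
      simp

lemma AltWalk.right_mem {p : List (β × α)} {u v : α} {c d : Fin 2} (h : AltWalk G φ u c p v d)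
    (hp : p ≠ []) : v ∈ p.map Prod.snd := by
  obtain ⟨p, s, rfl⟩ := (List.eq_nil_or_concat' p).resolve_left hp
  obtain ⟨x, b, -, hs⟩ := altWalk_append.1 h
  simp [(altWalk_singleton.1 hs).2.2.1]

lemma AltWalk.invariant {p : List (β × α)} {u v : α} {c d : Fin 2} (h : AltWalk G φ u c p v d)
    {P : α → Fin 2 → Prop} (hu : P u c)
    (hP : ∀ e ∈ p.map Prod.fst, ∀ x y, G.IsLink e x y → P x (φ e) → P y (φ e).rev) : P v d := by
  induction p generalizing u c with
  | nil =>
    obtain ⟨-, rfl, rfl⟩ := altWalk_nil.1 h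
    exact hu
  | cons s p ih =>
    obtain ⟨hl, rfl, h⟩ := altWalk_cons.1 h
    exact ih h (hP s.1 (by simp) _ _ hl hu) fun e he => hP e (List.mem_cons_of_mem _ he)

/-- Weakening of `ColourConnected`: any two distinct vertices are joined by alternating walks with
either colour of the first edge. -/
def AltWalkConnected (G : Graph α β) (φ : β → Fin 2) : Prop :=
  ∀ u ∈ V(G), ∀ v ∈ V(G), u ≠ v → ∀ c, ∃ p d, AltWalk G φ u c p v d

lemma IsAltPath.exists_altWalk {p : List (β × α)} {u v : α} {c : Fin 2}
    (h : IsAltPath G φ u p v) (hc : (colours φ p).head? = some c) :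
    ∃ d, AltWalk G φ u c p v d := by
  obtain ⟨hw, -, ha⟩ := h
  obtain ⟨l, hl⟩ := List.head?_eq_some_iff.1 hc
  have hne : colours φ p ≠ [] := by simp [hl]
  refine ⟨((colours φ p).getLast hne).rev, hw, ?_⟩
  rw [Alternates, ← List.cons_append, List.isChain_append, List.getLast?_cons_of_ne_nil hne]
  refine ⟨?_, List.isChain_singleton _, ?_⟩
  · rw [hl] at ha ⊢
    exact List.isChain_cons_cons.2 ⟨rev_ne_self c, ha⟩
  · simpa [List.getLast?_eq_some_getLast hne] using (rev_ne_self _).symm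

lemma IsAltPath.exists_head?_colours {p : List (β × α)} {u v : α} (h : IsAltPath G φ u p v)
    (huv : u ≠ v) : ∃ c, (colours φ p).head? = some c := by
  cases p with
  | nil => exact absurd h.1.2 huv
  | cons s p => exact ⟨φ s.1, rfl⟩

lemma ColourConnected.altWalkConnected (h : ColourConnected G φ) : AltWalkConnected G φ := by
  intro u hu v hv huv c
  obtain ⟨p, q, hp, hq, -, hpq⟩ := h u hu v hv huv
  obtain ⟨a, ha⟩ := hp.exists_head?_colours huv
  obtain ⟨b, hb⟩ := hq.exists_head?_colours huv
  have hba : b ≠ a := by simpa [List.getLast?_append, List.head?_append, ha, hb] using hpq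
  rcases eq_or_ne c a with rfl | hca
  · exact ⟨p, hp.exists_altWalk ha⟩
  · obtain rfl : b = c := (eq_rev_of_ne hba).trans (eq_rev_of_ne hca).symm
    exact ⟨q, hq.exists_altWalk hb⟩

/-! ### Tours -/

/-- `S` is the set of vertices and `E` the set of edges of an alternating closed trail. -/
def IsTour (G : Graph α β) (φ : β → Fin 2) (S : Set α) (E : Set β) : Prop :=
  ∃ u c p, p ≠ [] ∧ AltWalk G φ u c p u c ∧ (p.map Prod.fst).Nodup ∧
    S = {v | v ∈ p.map Prod.snd} ∧ E = {e | e ∈ p.map Prod.fst}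

lemma isAltClosedTrail_iff {u : α} {p : List (β × α)} :
    IsAltClosedTrail G φ u p ↔ p ≠ [] ∧ (∃ c, AltWalk G φ u c p u c) ∧ (p.map Prod.fst).Nodup := by
  refine and_congr_right fun hp => ?_
  have hne : colours φ p ≠ [] := by simpa [colours] using hp
  rw [alternatesCyclically_iff hne, and_comm (a := List.Nodup _), ← and_assoc, ← exists_and_left]
  rfl

lemma supereulerian_iff : Supereulerian G φ ↔ ∃ E, IsTour G φ V(G) E := by
  simp only [Supereulerian, isAltClosedTrail_iff]
  constructor
  · rintro ⟨u, p, ⟨hp, ⟨c, hw⟩, hn⟩, hV⟩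
    exact ⟨_, u, c, p, hp, hw, hn, Set.Subset.antisymm hV fun v hv => hw.1.mem_vertexSet hv, rfl⟩
  · rintro ⟨_, u, c, p, hp, hw, hn, hV, rfl⟩
    exact ⟨u, p, ⟨hp, ⟨c, hw⟩, hn⟩, fun v hv => by rwa [hV] at hv⟩

variable {S T W : Set α} {E F Q : Set β} {e f g : β} {x y z v w : α} {c d : Fin 2}

namespace IsTour

lemma of_le (h : IsTour H φ S E) (hHG : H ≤ G) : IsTour G φ S E := by
  obtain ⟨u, c, p, hp, ⟨hw, ha⟩, h⟩ := h
  exact ⟨u, c, p, hp, ⟨hw.of_le hHG, ha⟩, h⟩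

lemma finite (h : IsTour G φ S E) : S.Finite := by
  obtain ⟨-, -, p, -, -, -, rfl, -⟩ := h
  exact List.finite_toSet _

lemma subset_vertexSet (h : IsTour G φ S E) : S ⊆ V(G) := by
  obtain ⟨u, c, p, -, hw, -, rfl, -⟩ := h
  exact fun v hv => hw.1.mem_vertexSet hv

lemma nonempty (h : IsTour G φ S E) : S.Nonempty := by
  obtain ⟨u, c, p, hp, hw, -, rfl, -⟩ := h
  exact ⟨u, hw.right_mem hp⟩

lemma exists_link_of_mem (h : IsTour G φ S E) (hx : x ∈ S) : ∃ e ∈ E, ∃ y, G.IsLink e y x := by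
  obtain ⟨u, c, p, -, hw, -, rfl, rfl⟩ := h
  obtain ⟨s, hs, rfl⟩ := List.mem_map.1 hx
  obtain ⟨-, -, y, -, -, hl, -⟩ := hw.exists_eq_append_cons hs
  exact ⟨s.1, List.mem_map_of_mem hs, y, hl⟩

lemma exists_open (h : IsTour G φ S E) (he : e ∈ E) (hl : G.IsLink e x y) :
    ∃ p, AltWalk G φ y (φ e).rev p x (φ e) ∧ (e :: p.map Prod.fst).Nodup ∧
      S = {v | v ∈ y :: p.map Prod.snd} ∧ E = {f | f ∈ e :: p.map Prod.fst} := by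
  obtain ⟨u, c, p, -, hw, hn, rfl, rfl⟩ := h
  obtain ⟨⟨e, z⟩, hs, rfl⟩ := List.mem_map.1 he
  obtain ⟨p₁, p₂, w, rfl, hw₁, hl', hw₂⟩ := hw.exists_eq_append_cons hs
  have hp : AltWalk G φ z (φ e).rev (p₂ ++ p₁) w (φ e) := hw₂.append hw₁
  have hperm : (p₁ ++ (e, z) :: p₂).Perm ((e, z) :: (p₂ ++ p₁)) := List.perm_append_comm
  have hn : (e :: (p₂ ++ p₁).map Prod.fst).Nodup := (hperm.map _).nodup hn
  have hS : {v | v ∈ (p₁ ++ (e, z) :: p₂).map Prod.snd} = {v | v ∈ z :: (p₂ ++ p₁).map Prod.snd} :=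
    Set.ext fun v => (hperm.map _).mem_iff
  have hE : {f | f ∈ (p₁ ++ (e, z) :: p₂).map Prod.fst} = {f | f ∈ e :: (p₂ ++ p₁).map Prod.fst} :=
    Set.ext fun f => (hperm.map _).mem_iff
  rw [hS, hE]
  rcases hl'.eq_and_eq_or_eq_and_eq hl with ⟨rfl, rfl⟩ | ⟨rfl, rfl⟩
  · exact ⟨_, hp, hn, rfl, rfl⟩
  · obtain ⟨q, hq, hfst, hsnd⟩ := hp.exists_reverse
    rw [Fin.rev_rev] at hq
    refine ⟨q, hq, ?_, ?_, ?_⟩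
    · rw [hfst]
      exact ((List.reverse_perm _).cons e).nodup_iff.2 hn
    · simp only [hsnd, List.mem_reverse]
    · simp only [hfst, List.mem_cons, List.mem_reverse]

lemma left_mem (h : IsTour G φ S E) (he : e ∈ E) (hl : G.IsLink e x y) : x ∈ S := by
  obtain ⟨p, -, -, rfl, -⟩ := h.exists_open he hl.symm
  exact List.mem_cons_self

lemma right_mem (h : IsTour G φ S E) (he : e ∈ E) (hl : G.IsLink e x y) : y ∈ S :=
  h.left_mem he hl.symm

lemma exists_isLink (h : IsTour G φ S E) (he : e ∈ E) : ∃ x y, G.IsLink e x y := by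
  obtain ⟨u, c, p, -, hw, -, -, rfl⟩ := h
  obtain ⟨s, hs, rfl⟩ := List.mem_map.1 he
  obtain ⟨-, -, x, -, -, hl, -⟩ := hw.exists_eq_append_cons hs
  exact ⟨x, s.2, hl⟩

lemma disjoint_edges (h : IsTour G φ S E) (h' : IsTour G φ T F) (hST : Disjoint S T) :
    Disjoint E F := by
  rw [Set.disjoint_left] at hST ⊢
  intro e he he'
  obtain ⟨x, y, hl⟩ := h.exists_isLink he
  exact hST (h.left_mem he hl) (h'.left_mem he' hl)

lemma exists_altWalk (h : IsTour G φ S E) (hx : x ∈ S) (c : Fin 2) :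
    ∃ p, p ≠ [] ∧ AltWalk G φ x c p x c ∧ (p.map Prod.fst).Nodup ∧
      S = {v | v ∈ p.map Prod.snd} ∧ E = {e | e ∈ p.map Prod.fst} := by
  obtain ⟨e, he, y, hl⟩ := h.exists_link_of_mem hx
  rcases eq_or_ne (φ e) c with rfl | hc
  · obtain ⟨p, hp, hn, hS, hE⟩ := h.exists_open he hl.symm
    exact ⟨(e, y) :: p, by simp, altWalk_cons.2 ⟨hl.symm, rfl, hp⟩, hn, hS, hE⟩
  · obtain ⟨p, hp, hn, hS, hE⟩ := h.exists_open he hl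
    obtain rfl : (φ e).rev = c := by rw [eq_rev_of_ne hc, Fin.rev_rev]
    refine ⟨p ++ [(e, x)], by simp, hp.append (altWalk_singleton.2 ⟨hl, rfl, rfl, rfl⟩), ?_, ?_, ?_⟩
    · simpa using (List.perm_append_singleton e (p.map Prod.fst)).nodup_iff.2 hn
    · simp [hS, or_comm]
    · simp [hE, or_comm]

lemma exists_link (h : IsTour G φ S E) (hx : x ∈ S) (c : Fin 2) :
    ∃ e ∈ E, ∃ y ∈ S, G.IsLink e x y ∧ φ e = c := by
  obtain ⟨p, hp, hw, -, -, hE⟩ := h.exists_altWalk hx c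
  obtain ⟨s, p, rfl⟩ := List.exists_cons_of_ne_nil hp
  obtain ⟨hl, hc, -⟩ := altWalk_cons.1 hw
  have he : s.1 ∈ E := by simp [hE]
  exact ⟨s.1, he, s.2, h.right_mem he hl, hl, hc⟩

lemma splice (h : IsTour G φ S E) (h' : IsTour G φ T F) (hEF : Disjoint E F) (hx : x ∈ S)
    (hx' : x ∈ T) : IsTour G φ (S ∪ T) (E ∪ F) := by
  obtain ⟨p, hp, hpw, hpn, rfl, rfl⟩ := h.exists_altWalk hx 0
  obtain ⟨q, -, hqw, hqn, rfl, rfl⟩ := h'.exists_altWalk hx' 0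
  refine ⟨x, 0, p ++ q, by simp [hp], hpw.append hqw, ?_, ?_, ?_⟩
  · rw [List.map_append]
    exact hpn.append hqn (Set.disjoint_left.1 hEF)
  · simp only [List.map_append, List.mem_append, Set.ofPred_or]
  · simp only [List.map_append, List.mem_append, Set.ofPred_or]

lemma replace_edge (h : IsTour G φ S E) (he : e ∈ E) (hl : G.IsLink e x y) {q : List (β × α)}
    (hq : AltWalk G φ x (φ e) q y (φ e).rev) (hqn : (q.map Prod.fst).Nodup)
    (hqE : ∀ f ∈ q.map Prod.fst, f ∉ E) :
    ∃ F, F ⊆ E ∪ {f | f ∈ q.map Prod.fst} ∧ IsTour G φ (S ∪ {v | v ∈ q.map Prod.snd}) F := by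
  obtain ⟨p, hp, hpn, rfl, rfl⟩ := h.exists_open he hl
  have hq0 : q ≠ [] := by
    rintro rfl
    exact rev_ne_self _ (altWalk_nil.1 hq).2.2.symm
  have hy : y ∈ q.map Prod.snd := hq.right_mem hq0
  refine ⟨{f | f ∈ (q ++ p).map Prod.fst}, ?_, x, φ e, q ++ p, by simp [hq0], hq.append hp, ?_, ?_,
    rfl⟩
  · intro f
    simp only [List.map_append, Set.mem_ofPred_eq, List.mem_append, Set.mem_union, List.mem_cons]
    tauto
  · rw [List.map_append]
    exact hqn.append (List.nodup_cons.1 hpn).2 fun f hf hf' => hqE f hf (List.mem_cons_of_mem _ hf')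
  · ext v
    simp only [List.map_append, Set.mem_ofPred_eq, List.mem_append, Set.mem_union, List.mem_cons]
    grind

lemma exists_altWalk_of_isLink (h : IsTour G φ S E) (he : e ∈ E) (hl : G.IsLink e x y)
    (hf : G.IsLink f v x) (hg : G.IsLink g y w) (hfc : φ f = φ e) (hgc : φ g = φ e) (hfg : f ≠ g)
    (hfE : f ∉ E) (hgE : g ∉ E) :
    ∃ p, AltWalk G φ v (φ e) p w (φ e).rev ∧ (p.map Prod.fst).Nodup ∧
      (∀ i ∈ p.map Prod.fst, i = f ∨ i = g ∨ i ∈ E) ∧ S ⊆ {u | u ∈ p.map Prod.snd} := by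
  obtain ⟨p, hp, hpn, rfl, rfl⟩ := h.exists_open he hl.symm
  refine ⟨(f, x) :: (p ++ [(g, w)]), ?_, ?_, ?_, ?_⟩
  · exact altWalk_cons.2 ⟨hf, hfc, hp.append (altWalk_singleton.2 ⟨hg, hgc, rfl, rfl⟩)⟩
  · simp only [Set.mem_ofPred_eq, List.map_cons, List.map_append, List.map_nil, List.nodup_cons,
      List.nodup_append, List.mem_append, List.mem_cons] at hpn hfE hgE ⊢
    grind
  · simp only [Set.mem_ofPred_eq, List.map_cons, List.map_append, List.map_nil, List.mem_cons,
      List.mem_append]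
    grind
  · intro u
    simp only [Set.mem_ofPred_eq, List.map_cons, List.map_append, List.mem_cons, List.mem_append]
    tauto

lemma invariant (h : IsTour G φ S E) {P : α → Fin 2 → Prop} (hx : x ∈ S) (hxc : P x c)
    (hP : ∀ e ∈ E, ∀ v w, G.IsLink e v w → P v (φ e) → P w (φ e).rev) (hy : y ∈ S) :
    ∃ d, P y d := by
  obtain ⟨p, -, hp, -, rfl, rfl⟩ := h.exists_altWalk hx c
  obtain ⟨s, hs, rfl⟩ := List.mem_map.1 hy
  obtain ⟨p₁, p₂, z, rfl, hp₁, hl, -⟩ := hp.exists_eq_append_cons hs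
  refine ⟨_, hP s.1 (List.mem_map_of_mem hs) z s.2 hl (hp₁.invariant hxc fun e he => hP e ?_)⟩
  rw [Set.mem_ofPred_eq, List.map_append]
  exact List.mem_append_left _ he

lemma invariant_isLink (h : IsTour G φ S E) {P : α → Fin 2 → Prop} (he : e ∈ E)
    (hl : G.IsLink e x y) (hxc : P x c)
    (hP : ∀ e ∈ E, ∀ v w, G.IsLink e v w → P v (φ e) → P w (φ e).rev) : P y c.rev := by
  rcases eq_or_ne c (φ e) with rfl | hc
  · exact hP e he x y hl hxc
  · obtain ⟨p, hp, -, -, rfl⟩ := h.exists_open he hl.symm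
    obtain rfl := eq_rev_of_ne hc
    rw [Fin.rev_rev]
    exact hp.invariant hxc fun f hf => hP f (List.mem_cons_of_mem _ hf)

lemma exists_boundary (h : IsTour G φ S E) {N : Set α} (hx : x ∈ S) (hxN : x ∈ N) (hy : y ∈ S)
    (hyN : y ∉ N) : ∃ e ∈ E, ∃ v w, G.IsLink e v w ∧ v ∈ N ∧ w ∉ N := by
  by_contra! hcon
  obtain ⟨-, hy'⟩ := h.invariant (P := fun v _ => v ∈ N) (c := 0) hx hxN
    (fun e he v w hl hv => hcon e he v w hl hv) hy
  exact hyN hy'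

end IsTour

lemma IsTour.union_sUnion {𝒯 : Finset (Set α)} {E : Set α → Set β} (hW : IsTour G φ W Q)
    (h𝒯 : ∀ T ∈ 𝒯, IsTour G φ T (E T)) (hE : (𝒯 : Set (Set α)).PairwiseDisjoint E)
    (hQ : ∀ T ∈ 𝒯, Disjoint Q (E T)) (hmeet : ∀ T ∈ 𝒯, (W ∩ T).Nonempty) :
    IsTour G φ (W ∪ ⋃₀ 𝒯) (Q ∪ ⋃ T ∈ 𝒯, E T) := by
  classical
  induction 𝒯 using Finset.induction_on with
  | empty => simpa using hW
  | insert T 𝒯 hT ih =>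
    rw [Finset.coe_insert, Set.pairwiseDisjoint_insert] at hE
    simp only [Finset.forall_mem_insert] at h𝒯 hQ hmeet
    obtain ⟨x, hxW, hxT⟩ := hmeet.1
    have hdisj : Disjoint (Q ∪ ⋃ R ∈ 𝒯, E R) (E T) := by
      simp only [Set.disjoint_union_left, Set.disjoint_iUnion_left]
      exact ⟨hQ.1, fun R hR => (hE.2 R hR (by rintro rfl; exact hT hR)).symm⟩
    convert (ih h𝒯.2 hE.1 hQ.2 hmeet.2).splice h𝒯.1 hdisj (Or.inl hxW) hxT using 1
    · rw [Finset.coe_insert, Set.sUnion_insert, Set.union_assoc, Set.union_comm T]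
    · rw [Finset.set_biUnion_insert, Set.union_assoc, Set.union_comm (E T)]

lemma isTour_pair (hl : G.IsLink e x y) (hl' : G.IsLink f x y) (hef : φ e ≠ φ f) :
    IsTour G φ {y, x} {e, f} := by
  have hf : φ f = (φ e).rev := eq_rev_of_ne hef.symm
  refine ⟨x, φ e, [(e, y), (f, x)], by simp, ?_, ?_, by ext; simp, by ext; simp⟩
  · simp [altWalk_cons, altWalk_nil, hl, hl'.symm, hf, hl.left_mem]
  · simpa using ne_of_apply_ne φ hef

lemma isTour_four_cycle {k : β} (he : G.IsLink e x y) (hf : G.IsLink f y z) (hg : G.IsLink g z w)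
    (hk : G.IsLink k w x) (hec : φ e = c) (hfc : φ f = c.rev) (hgc : φ g = c) (hkc : φ k = c.rev)
    (heg : e ≠ g) (hfk : f ≠ k) : IsTour G φ {y, z, w, x} {e, f, g, k} := by
  refine ⟨x, c, [(e, y), (f, z), (g, w), (k, x)], by simp, ?_, ?_, by ext; simp, by ext; simp⟩
  · simp [altWalk_cons, altWalk_nil, he, hf, hg, hk, hec, hfc, hgc, hkc, he.left_mem]
  · have hne {i j : β} (hi : φ i = c) (hj : φ j = c.rev) : i ≠ j := by
      rintro rfl
      exact rev_ne_self c (hj.symm.trans hi)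
    simp [heg, hfk, hne hec hfc, hne hec hkc, (hne hgc hfc).symm, hne hgc hkc]

lemma altWalk_map_range {u : ℕ → α} {g : ℕ → β} (hl : ∀ n, G.IsLink (g n) (u n) (u (n + 1)))
    (hφ : ∀ n, φ (g (n + 1)) = (φ (g n)).rev) (n : ℕ) :
    AltWalk G φ (u 0) (φ (g 0)) ((List.range n).map fun i => (g i, u (i + 1))) (u n) (φ (g n)) := by
  induction n with
  | zero => exact altWalk_nil.2 ⟨(hl 0).left_mem, rfl, rfl⟩
  | succ n ih =>
    rw [List.range_succ, List.map_append]
    exact ih.append (altWalk_singleton.2 ⟨hl n, rfl, rfl, (hφ n).symm⟩)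

lemma nonempty_periodicPts {ι : Type*} [Finite ι] [Nonempty ι] (s : ι → ι) :
    (Function.periodicPts s).Nonempty := by
  inhabit ι
  obtain ⟨m, n, hmn, heq⟩ := Set.finite_univ.exists_lt_map_eq_of_forall_mem
    (f := fun n => s^[n] default) fun _ => Set.mem_univ _
  refine ⟨s^[m] default, Function.mk_mem_periodicPts (Nat.sub_pos_of_lt hmn) ?_⟩
  rw [Function.IsPeriodicPt, Function.IsFixedPt, ← Function.iterate_add_apply,
    Nat.sub_add_cancel hmn.le]
  exact heq.symm

/-- Following, from each vertex, an edge of its own colour to a vertex of the other colour, one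
eventually runs into an alternating cycle. -/
lemma exists_isTour_of_forall_exists_isLink {N : Set α} (hN : N.Finite) (hne : N.Nonempty)
    (col : α → Fin 2)
    (h : ∀ v ∈ N, ∃ e, ∃ w ∈ N, G.IsLink e v w ∧ φ e = col v ∧ col w ≠ col v) :
    ∃ W Q, IsTour G φ W Q ∧
      ∀ e ∈ Q, ∃ v ∈ N, ∃ w ∈ N, G.IsLink e v w ∧ col w ≠ col v := by
  have : Finite N := hN
  have : Nonempty N := hne.to_subtype
  choose g s hsN hl hg hs using fun v : N => h v v.2
  let t : N → N := fun v => ⟨s v, hsN v⟩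
  obtain ⟨v, hv⟩ := nonempty_periodicPts t
  have hsucc (n : ℕ) : t^[n + 1] v = t (t^[n] v) := Function.iterate_succ_apply' t n v
  have hlink (n : ℕ) : G.IsLink (g (t^[n] v)) (t^[n] v : N) (t^[n + 1] v : N) := by
    rw [hsucc]
    exact hl _
  have hcol (n : ℕ) : φ (g (t^[n + 1] v)) = (φ (g (t^[n] v))).rev := by
    rw [hsucc, hg, hg]
    exact eq_rev_of_ne (hs _)
  have hginj {a b : N} (hab : g a = g b) : a = b := by
    rcases (hl a).left_eq_or_eq (hab ▸ hl b) with h | h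
    · exact Subtype.ext h
    · refine absurd ?_ (hs b)
      rw [← h, ← hg a, hab, hg b]
  have hw := altWalk_map_range hlink hcol (Function.minimalPeriod t v)
  rw [Function.iterate_minimalPeriod] at hw
  refine ⟨_, _, ⟨_, _, _, ?_, hw, ?_, rfl, rfl⟩, ?_⟩
  · simpa using (Function.minimalPeriod_pos_of_mem_periodicPts hv).ne'
  · rw [List.map_map]
    refine List.Nodup.map_on (fun i hi j hj hij => ?_) List.nodup_range
    exact Function.iterate_injOn_Iio_minimalPeriod (List.mem_range.1 hi) (List.mem_range.1 hj)
      (hginj hij)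
  · intro e he
    simp only [List.map_map, Set.mem_ofPred_eq, List.mem_map, Function.comp_apply] at he
    obtain ⟨i, -, rfl⟩ := he
    exact ⟨_, (t^[i] v).2, _, (t (t^[i] v)).2, hl _, hs _⟩

/-! ### Colour adjacency -/

/-- `x` and `y` are joined by an edge of colour `c`. -/
def ColAdj (G : Graph α β) (φ : β → Fin 2) (c : Fin 2) (x y : α) : Prop :=
  ∃ e, G.IsLink e x y ∧ φ e = c

lemma ColAdj.symm (h : ColAdj G φ c x y) : ColAdj G φ c y x := by
  obtain ⟨e, hl, hc⟩ := h
  exact ⟨e, hl.symm, hc⟩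

/-- `x` and `y` have the same neighbours in each colour, like two vertices of an extension that
replace the same vertex. -/
def Twins (G : Graph α β) (φ : β → Fin 2) (x y : α) : Prop :=
  ∀ c z, ColAdj G φ c x z ↔ ColAdj G φ c y z

/-- The ends of every monochromatic path of length two are adjacent or twins. This is what an
extension retains of the property `MClosed` of the graph that is extended. -/
def MClosedUpToTwins (G : Graph α β) (φ : β → Fin 2) : Prop :=
  ∀ c x y z, ColAdj G φ c x y → ColAdj G φ c y z → Twins G φ x z ∨ ∃ d, ColAdj G φ d x z

namespace IsExtension

variable {M : Graph γ δ} {ψ : δ → Fin 2}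

lemma loopless (h : IsExtension M ψ G φ) : G.Loopless := by
  obtain ⟨-, π, -, hind, -⟩ := h
  rw [Graph.loopless_iff_forall_ne_of_adj]
  rintro x y hxy rfl
  exact hind x hxy.left_mem x hxy.left_mem rfl hxy

lemma vertexSet_nonempty (h : IsExtension M ψ G φ) : V(G).Nonempty := by
  obtain ⟨hM, π, hπ, -⟩ := h
  rw [← Set.image_nonempty, hπ]
  exact hM.nonempty

lemma mClosedUpToTwins (h : IsExtension M ψ G φ) (hM : MClosed M ψ) : MClosedUpToTwins G φ := by
  obtain ⟨-, π, -, hind, hadj⟩ := h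
  have hne {c x y} (h : ColAdj G φ c x y) : π x ≠ π y := by
    obtain ⟨e, hl, -⟩ := h
    exact fun hπ => hind x hl.left_mem y hl.right_mem hπ hl.adj
  have hlink {c x y} (h : ColAdj G φ c x y) : ∃ f, M.IsLink f (π x) (π y) ∧ ψ f = c := by
    obtain ⟨e, hl, -⟩ := id h
    exact (hadj x hl.left_mem y hl.right_mem (hne h) c).1 h
  have htwin {c x x' y} (h : ColAdj G φ c x y) (hx' : x' ∈ V(G)) (hπ : π x = π x') :
      ColAdj G φ c x' y := by
    obtain ⟨e, hl, -⟩ := id h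
    exact (hadj x' hx' y hl.right_mem (hπ ▸ hne h) c).2 (hπ ▸ hlink h)
  intro c x y z hxy hyz
  obtain ⟨f, hf, hfc⟩ := hlink hxy
  obtain ⟨g, hg, hgc⟩ := hlink hyz
  obtain ⟨e, he, -⟩ := id hxy
  obtain ⟨e', he', -⟩ := id hyz
  by_cases hπ : π x = π z
  · exact Or.inl fun d w =>
      ⟨fun h => htwin h he'.right_mem hπ, fun h => htwin h he.left_mem hπ.symm⟩
  · obtain ⟨k, hk⟩ := hM _ _ _ f g (hne hxy) (hne hyz) hπ hf hg (hfc.trans hgc.symm)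
    exact Or.inr ⟨ψ k, (hadj x he.left_mem z he'.right_mem hπ _).2 ⟨k, hk, rfl⟩⟩

end IsExtension

/-! ### Factors -/

/-- A partition of the vertices into the vertex sets of tours. The tours need not use all edges of
the subgraphs that they span, so it is their vertex sets that make up the factor. -/
structure IsTourFactor (G : Graph α β) (φ : β → Fin 2) (𝒜 : Finset (Set α)) : Prop where
  pairwiseDisjoint : (𝒜 : Set (Set α)).PairwiseDisjoint id
  sUnion_eq : ⋃₀ (𝒜 : Set (Set α)) = V(G)
  exists_isTour : ∀ S ∈ 𝒜, ∃ E, IsTour G φ S E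

lemma HasEulerianFactor.exists_isTourFactor (h : HasEulerianFactor G φ) :
    ∃ 𝒜, IsTourFactor G φ 𝒜 := by
  classical
  obtain ⟨k, S, hdisj, hcov, htour⟩ := h
  refine ⟨Finset.univ.image S, ?_, by simpa using hcov, ?_⟩
  · rintro A hA B hB hAB
    obtain ⟨i, -, rfl⟩ := Finset.mem_image.1 hA
    obtain ⟨j, -, rfl⟩ := Finset.mem_image.1 hB
    exact hdisj i j fun h => hAB (congrArg S h)
  · simp only [Finset.mem_image, Finset.mem_univ, true_and, forall_exists_index,
      forall_apply_eq_imp_iff]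
    intro i
    obtain ⟨E, hE⟩ := supereulerian_iff.1 (htour i)
    exact ⟨E, hE.of_le (Graph.induce_le (hcov ▸ Set.subset_iUnion S i))⟩

variable {𝒜 ℬ : Finset (Set α)} {R U : Set α} {ℰ : Set α → Set β}

lemma IsTourFactor.eq_of_mem (h : IsTourFactor G φ 𝒜) (hS : S ∈ 𝒜) (hT : T ∈ 𝒜) (hxS : x ∈ S)
    (hxT : x ∈ T) : S = T :=
  h.pairwiseDisjoint.elim_set hS hT x hxS hxT

lemma IsTourFactor.exists_mem (h : IsTourFactor G φ 𝒜) (hx : x ∈ V(G)) : ∃ S ∈ 𝒜, x ∈ S := by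
  rwa [← h.sUnion_eq] at hx

lemma IsTourFactor.merge [DecidableEq (Set α)] (h : IsTourFactor G φ 𝒜) (hsub : ℬ ⊆ 𝒜)
    (hE : IsTour G φ (⋃₀ (ℬ : Set (Set α))) E) :
    IsTourFactor G φ (insert (⋃₀ (ℬ : Set (Set α))) (𝒜 \ ℬ)) := by
  refine ⟨?_, ?_, ?_⟩
  · rw [Finset.coe_insert, Finset.coe_sdiff, Set.pairwiseDisjoint_insert]
    refine ⟨h.pairwiseDisjoint.subset Set.sdiff_subset, fun S hS _ => ?_⟩
    refine Set.disjoint_sUnion_left.2 fun T hT => h.pairwiseDisjoint (hsub hT) hS.1 ?_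
    rintro rfl
    exact hS.2 hT
  · rw [Finset.coe_insert, Set.sUnion_insert, Finset.coe_sdiff, ← Set.sUnion_union,
      Set.union_sdiff_cancel (Finset.coe_subset.2 hsub), h.sUnion_eq]
  · simp only [Finset.forall_mem_insert]
    exact ⟨⟨E, hE⟩, fun S hS => h.exists_isTour S (Finset.mem_sdiff.1 hS).1⟩

/-- A factor with as few members as possible, each `S ∈ 𝒜` with the edge set `ℰ S` of a tour. -/
structure IsMinimalTourFactor (G : Graph α β) (φ : β → Fin 2) (𝒜 : Finset (Set α))
    (ℰ : Set α → Set β) : Prop where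
  isTourFactor : IsTourFactor G φ 𝒜
  isTour : ∀ S ∈ 𝒜, IsTour G φ S (ℰ S)
  card_le : ∀ ℬ, IsTourFactor G φ ℬ → 𝒜.card ≤ ℬ.card

lemma IsTourFactor.exists_isMinimalTourFactor (h : IsTourFactor G φ 𝒜) :
    ∃ 𝒜 ℰ, IsMinimalTourFactor G φ 𝒜 ℰ := by
  obtain ⟨ℬ, hℬ, hmin⟩ := (measure Finset.card).wf.has_min {𝒜 | IsTourFactor G φ 𝒜} ⟨𝒜, h⟩
  choose! ℰ hℰ using IsTourFactor.exists_isTour hℬ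
  exact ⟨ℬ, ℰ, hℬ, hℰ, fun 𝒞 h𝒞 => not_lt.1 (hmin 𝒞 h𝒞)⟩

namespace IsMinimalTourFactor

lemma eq_of_isTour_sUnion (h : IsMinimalTourFactor G φ 𝒜 ℰ) (hsub : ℬ ⊆ 𝒜)
    (hE : IsTour G φ (⋃₀ (ℬ : Set (Set α))) E) (hS : S ∈ ℬ) (hT : T ∈ ℬ) : S = T := by
  classical
  have hmin := h.card_le _ (h.isTourFactor.merge hsub hE)
  have hins := Finset.card_insert_le (⋃₀ (ℬ : Set (Set α))) (𝒜 \ ℬ)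
  have hsdiff := Finset.card_sdiff_add_card_eq_card hsub
  exact Finset.card_le_one.1 (by lia) S hS T hT

lemma disjoint_edges (h : IsMinimalTourFactor G φ 𝒜 ℰ) (hS : S ∈ 𝒜) (hT : T ∈ 𝒜) (hST : S ≠ T) :
    Disjoint (ℰ S) (ℰ T) :=
  (h.isTour S hS).disjoint_edges (h.isTour T hT) (h.isTourFactor.pairwiseDisjoint hS hT hST)

lemma pairwiseDisjoint_edges (h : IsMinimalTourFactor G φ 𝒜 ℰ) :
    (𝒜 : Set (Set α)).PairwiseDisjoint ℰ :=
  fun _ hS _ hT hST => h.disjoint_edges hS hT hST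

lemma ne (h : IsMinimalTourFactor G φ 𝒜 ℰ) (hS : S ∈ 𝒜) (hT : T ∈ 𝒜) (hST : S ≠ T) (hx : x ∈ S)
    (hy : y ∈ T) : x ≠ y := by
  rintro rfl
  exact hST (h.isTourFactor.eq_of_mem hS hT hx hy)

lemma notMem_edges (h : IsMinimalTourFactor G φ 𝒜 ℰ) (hS : S ∈ 𝒜) (hT : T ∈ 𝒜) (hST : S ≠ T)
    (hx : x ∈ S) (hy : y ∈ T) (hl : G.IsLink e x y) (hR : R ∈ 𝒜) : e ∉ ℰ R := by
  intro he
  refine hST ((h.isTourFactor.eq_of_mem hS hR hx ?_).trans (h.isTourFactor.eq_of_mem hR hT ?_ hy))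
  exacts [(h.isTour R hR).left_mem he hl, (h.isTour R hR).right_mem he hl]

/-- Otherwise the tour could be combined with all members of the factor that it meets. -/
lemma subset_of_isTour (h : IsMinimalTourFactor G φ 𝒜 ℰ) (hW : IsTour G φ W Q)
    (hQ : ∀ T ∈ 𝒜, ¬ T ⊆ W → Disjoint Q (ℰ T)) (hS : S ∈ 𝒜) (hxS : x ∈ S) (hxW : x ∈ W) :
    W ⊆ S := by
  classical
  let ℬ := 𝒜.filter fun T => (W ∩ T).Nonempty
  let 𝒯 := ℬ.filter fun T => ¬ T ⊆ W
  have hℬ : ℬ ⊆ 𝒜 := Finset.filter_subset _ _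
  have h𝒯 : 𝒯 ⊆ ℬ := Finset.filter_subset _ _
  have hmem {y} (hy : y ∈ W) : ∃ T ∈ ℬ, y ∈ T := by
    obtain ⟨T, hT, hyT⟩ := h.isTourFactor.exists_mem (hW.subset_vertexSet hy)
    exact ⟨T, Finset.mem_filter.2 ⟨hT, y, hy, hyT⟩, hyT⟩
  have hunion : W ∪ ⋃₀ (𝒯 : Set (Set α)) = ⋃₀ (ℬ : Set (Set α)) := by
    refine Set.Subset.antisymm (Set.union_subset (fun y hy => hmem hy)
      (Set.sUnion_subset_sUnion (Finset.coe_subset.2 h𝒯))) (Set.sUnion_subset fun T hT => ?_)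
    by_cases hTW : T ⊆ W
    · exact hTW.trans Set.subset_union_left
    · exact (Set.subset_sUnion_of_mem (Finset.mem_filter.2 ⟨hT, hTW⟩)).trans Set.subset_union_right
  have htour : IsTour G φ (⋃₀ (ℬ : Set (Set α))) (Q ∪ ⋃ T ∈ 𝒯, ℰ T) := by
    rw [← hunion]
    exact hW.union_sUnion (fun T hT => h.isTour T (hℬ (h𝒯 hT)))
      (h.pairwiseDisjoint_edges.subset (Finset.coe_subset.2 (h𝒯.trans hℬ)))
      (fun T hT => hQ T (hℬ (h𝒯 hT)) (Finset.mem_filter.1 hT).2)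
      (fun T hT => (Finset.mem_filter.1 (h𝒯 hT)).2)
  intro y hy
  obtain ⟨T, hT, hyT⟩ := hmem hy
  have hSℬ : S ∈ ℬ := Finset.mem_filter.2 ⟨hS, x, hxW, hxS⟩
  rwa [h.eq_of_isTour_sUnion hℬ htour hSℬ hT]

/-- Otherwise the tour of `S`, with `e` replaced by the walk `q`, could be combined with all members
of the factor that it meets. -/
lemma mem_of_altWalk (h : IsMinimalTourFactor G φ 𝒜 ℰ) (hS : S ∈ 𝒜) (he : e ∈ ℰ S)
    (hl : G.IsLink e x y) {q : List (β × α)} (hq : AltWalk G φ x (φ e) q y (φ e).rev)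
    (hqn : (q.map Prod.fst).Nodup) (hqS : ∀ f ∈ q.map Prod.fst, f ∉ ℰ S)
    (hq𝒜 : ∀ T ∈ 𝒜, (∃ f ∈ q.map Prod.fst, f ∈ ℰ T) → ∀ v ∈ T, v ∈ q.map Prod.snd)
    (hv : v ∈ q.map Prod.snd) : v ∈ S := by
  obtain ⟨Q, hQ, hW⟩ := (h.isTour S hS).replace_edge he hl hq hqn hqS
  have hxS := (h.isTour S hS).left_mem he hl
  refine h.subset_of_isTour hW (fun T hT hTW => ?_) hS hxS (Or.inl hxS) (Or.inr hv)
  have hST : S ≠ T := by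
    rintro rfl
    exact hTW Set.subset_union_left
  refine Disjoint.mono_left hQ (Set.disjoint_union_left.2 ⟨h.disjoint_edges hS hT hST, ?_⟩)
  rw [Set.disjoint_left]
  intro f hf hfT
  have hTq : T ⊆ {v | v ∈ q.map Prod.snd} := hq𝒜 T hT ⟨f, hf, hfT⟩
  exact hTW (hTq.trans Set.subset_union_right)

lemma mem_of_detour (h : IsMinimalTourFactor G φ 𝒜 ℰ) (hS : S ∈ 𝒜) (he : e ∈ ℰ S)
    (hl : G.IsLink e x y) {i j k : β} (hi : G.IsLink i x v) (hj : G.IsLink j v w)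
    (hk : G.IsLink k w y) (hic : φ i = φ e) (hjc : φ j = (φ e).rev) (hkc : φ k = φ e)
    (hik : i ≠ k) (h𝒜 : ∀ T ∈ 𝒜, i ∉ ℰ T ∧ j ∉ ℰ T ∧ k ∉ ℰ T) : v ∈ S := by
  have hij : i ≠ j := by
    rintro rfl
    exact rev_ne_self _ (hjc.symm.trans hic)
  have hjk : j ≠ k := by
    rintro rfl
    exact rev_ne_self _ (hjc.symm.trans hkc)
  have hnot : ∀ T ∈ 𝒜, ∀ f ∈ [(i, v), (j, w), (k, y)].map Prod.fst, f ∉ ℰ T := by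
    simpa using h𝒜
  refine h.mem_of_altWalk hS he hl (q := [(i, v), (j, w), (k, y)]) ?_ ?_ (hnot S hS) ?_ ?_
  · simp [altWalk_cons, altWalk_nil, hi, hj, hk, hic, hjc, hkc, hl.right_mem]
  · simp [hij, hik, hjk]
  · exact fun T hT ⟨f, hf, hfT⟩ => absurd hfT (hnot T hT f hf)
  · simp

end IsMinimalTourFactor

/-! ### Edges between two members of a minimal factor -/

/-- All edges from `x` to `T` have colour `c`, and there are such edges. -/
def MonoTo (G : Graph α β) (φ : β → Fin 2) (T : Set α) (x : α) (c : Fin 2) : Prop :=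
  (∃ y ∈ T, ColAdj G φ c x y) ∧ ∀ y ∈ T, ∀ d, ColAdj G φ d x y → d = c

/-- `x` is joined to all vertices in `T` by edges of colour `c`. -/
def FullTo (G : Graph α β) (φ : β → Fin 2) (T : Set α) (x : α) (c : Fin 2) : Prop :=
  ∀ y ∈ T, ColAdj G φ c x y

/-- Each vertex in `S` is joined to all vertices in `T` by edges of one colour, which may depend on
the vertex in `S`. -/
def Dominates (G : Graph α β) (φ : β → Fin 2) (S T : Set α) : Prop :=
  ∀ x ∈ S, ∃ c, FullTo G φ T x c

lemma exists_colAdj_of_not_monoTo (hx : ∀ c, ¬ MonoTo G φ T x c) (hy : y ∈ T)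
    (hxy : ColAdj G φ d x y) (c : Fin 2) : ∃ z ∈ T, ColAdj G φ c x z := by
  by_cases hdc : d = c
  · exact ⟨y, hy, hdc ▸ hxy⟩
  · have hd := hx d
    simp only [MonoTo, not_and, not_forall] at hd
    obtain ⟨z, hz, b, hxz, hbd⟩ := hd ⟨y, hy, hxy⟩
    refine ⟨z, hz, ?_⟩
    rwa [eq_rev_of_ne (Ne.symm hdc), ← eq_rev_of_ne hbd]

lemma exists_isTour_of_forall_not_monoTo (hS : S.Finite) (hT : T.Finite) (hST : Disjoint S T)
    (hmS : ∀ v ∈ S, ∀ d, ¬ MonoTo G φ T v d) (hmT : ∀ v ∈ T, ∀ d, ¬ MonoTo G φ S v d)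
    (hx : x ∈ S) (hy : y ∈ T) (hxy : ColAdj G φ c x y) :
    ∃ W Q, IsTour G φ W Q ∧ ∀ e ∈ Q, ∃ v ∈ S, ∃ w ∈ T, G.IsLink e v w := by
  classical
  let N : Set α := {v | (v ∈ S ∧ ∃ w ∈ T, ∃ d, ColAdj G φ d v w) ∨
    (v ∈ T ∧ ∃ w ∈ S, ∃ d, ColAdj G φ d v w)}
  let col : α → Fin 2 := fun v => if v ∈ S then 0 else 1
  have hNST : N ⊆ S ∪ T := by
    rintro v (⟨hv, -⟩ | ⟨hv, -⟩)
    exacts [Or.inl hv, Or.inr hv]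
  have hdisj {v} (hv : v ∈ T) : v ∉ S := Set.disjoint_right.1 hST hv
  have hstep : ∀ v ∈ N, ∃ e, ∃ w ∈ N, G.IsLink e v w ∧ φ e = col v ∧ col w ≠ col v := by
    rintro v (⟨hv, w, hw, d, hd⟩ | ⟨hv, w, hw, d, hd⟩)
    · obtain ⟨z, hz, e, hl, he⟩ := exists_colAdj_of_not_monoTo (hmS v hv) hw hd 0
      exact ⟨e, z, Or.inr ⟨hz, v, hv, 0, e, hl.symm, he⟩, hl, by simp [col, hv, he],
        by simp [col, hv, hdisj hz]⟩
    · obtain ⟨z, hz, e, hl, he⟩ := exists_colAdj_of_not_monoTo (hmT v hv) hw hd 1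
      exact ⟨e, z, Or.inl ⟨hz, v, hv, 1, e, hl.symm, he⟩, hl, by simp [col, hdisj hv, he],
        by simp [col, hz, hdisj hv]⟩
  obtain ⟨W, Q, hW, hQ⟩ := exists_isTour_of_forall_exists_isLink ((hS.union hT).subset hNST)
    ⟨x, Or.inl ⟨hx, y, hy, c, hxy⟩⟩ col hstep
  refine ⟨W, Q, hW, fun e he => ?_⟩
  obtain ⟨v, hv, w, hw, hl, hvw⟩ := hQ e he
  rcases hNST hv with hv | hv <;> rcases hNST hw with hw | hw
  · simp [col, hv, hw] at hvw
  · exact ⟨v, hv, w, hw, hl⟩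
  · exact ⟨w, hw, v, hv, hl.symm⟩
  · simp [col, hdisj hv, hdisj hw] at hvw

lemma not_dominates_self [G.Loopless] (hS : S.Nonempty) : ¬ Dominates G φ S S := by
  intro hD
  obtain ⟨x, hx⟩ := hS
  obtain ⟨c, hc⟩ := hD x hx
  obtain ⟨e, hl, -⟩ := hc x hx
  exact hl.ne rfl

namespace IsMinimalTourFactor

lemma eq_of_isTour (h : IsMinimalTourFactor G φ 𝒜 ℰ) (hW : IsTour G φ W Q)
    (hQ : ∀ e ∈ Q, ∀ R ∈ 𝒜, e ∉ ℰ R) (hS : S ∈ 𝒜) (hT : T ∈ 𝒜) (hxS : x ∈ S) (hxW : x ∈ W)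
    (hyT : y ∈ T) (hyW : y ∈ W) : S = T :=
  h.isTourFactor.eq_of_mem hS hT (h.subset_of_isTour hW
    (fun R hR _ => Set.disjoint_left.2 fun e he => hQ e he R hR) hS hxS hxW hyW) hyT

lemma colour_unique (h : IsMinimalTourFactor G φ 𝒜 ℰ) (hS : S ∈ 𝒜) (hT : T ∈ 𝒜) (hST : S ≠ T)
    (hx : x ∈ S) (hy : y ∈ T) (hc : ColAdj G φ c x y) (hd : ColAdj G φ d x y) : c = d := by
  obtain ⟨e, he, rfl⟩ := hc
  obtain ⟨f, hf, rfl⟩ := hd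
  by_contra hne
  refine hST (h.eq_of_isTour (isTour_pair he hf hne) ?_ hS hT hx (by simp) hy (by simp))
  rintro _ (rfl | rfl) R hR
  exacts [h.notMem_edges hS hT hST hx hy he hR, h.notMem_edges hS hT hST hx hy hf hR]

/-- Otherwise the edge `xx'` of the tour of `S` could be replaced by `xy`, the tour of `T` without
`yy'`, and `y'x'`. -/
lemma not_colAdj [G.Loopless] (h : IsMinimalTourFactor G φ 𝒜 ℰ) (hS : S ∈ 𝒜) (hT : T ∈ 𝒜)
    (hST : S ≠ T) {x' y' : α} (he : e ∈ ℰ S) (hl : G.IsLink e x x') (hf : f ∈ ℰ T)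
    (hl' : G.IsLink f y y') (hfe : φ f = φ e) (hxy : ColAdj G φ (φ e) x y) :
    ¬ ColAdj G φ (φ e) x' y' := by
  rintro ⟨k, hk, hkc⟩
  obtain ⟨g, hg, hgc⟩ := hxy
  have hx := (h.isTour S hS).left_mem he hl
  have hx' := (h.isTour S hS).right_mem he hl
  have hy := (h.isTour T hT).left_mem hf hl'
  have hy' := (h.isTour T hT).right_mem hf hl'
  have hgR {R} (hR : R ∈ 𝒜) : g ∉ ℰ R := h.notMem_edges hS hT hST hx hy hg hR
  have hkR {R} (hR : R ∈ 𝒜) : k ∉ ℰ R := h.notMem_edges hS hT hST hx' hy' hk hR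
  have hgk : g ≠ k := by
    rintro rfl
    rcases hg.left_eq_or_eq hk with hxx' | hxy'
    exacts [hl.ne hxx', h.ne hS hT hST hx hy' hxy']
  obtain ⟨q, hq, hqn, hqE, hTq⟩ := (h.isTour T hT).exists_altWalk_of_isLink hf hl' hg hk.symm
    (hgc.trans hfe.symm) (hkc.trans hfe.symm) hgk (hgR hT) (hkR hT)
  have hqR {R} (hR : R ∈ 𝒜) {i : β} (hi : i ∈ q.map Prod.fst) (hiR : i ∈ ℰ R) : R = T := by
    by_contra hRT
    rcases hqE i hi with rfl | rfl | hiT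
    exacts [hgR hR hiR, hkR hR hiR, Set.disjoint_left.1 (h.disjoint_edges hR hT hRT) hiR hiT]
  refine h.ne hS hT hST (h.mem_of_altWalk hS he hl (hfe ▸ hq) hqn
    (fun i hi hiS => hST (hqR hS hi hiS)) ?_ (hTq hy)) hy rfl
  rintro R hR ⟨i, hi, hiR⟩
  obtain rfl := hqR hR hi hiR
  exact hTq

lemma not_twins [G.Loopless] (h : IsMinimalTourFactor G φ 𝒜 ℰ) (hS : S ∈ 𝒜) (hT : T ∈ 𝒜)
    (hST : S ≠ T) (hx : x ∈ S) (hy : y ∈ T) : ¬ Twins G φ x y := by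
  intro hxy
  obtain ⟨e, he, x', -, hl, hec⟩ := (h.isTour S hS).exists_link hx 0
  obtain ⟨f, hf, y', -, hl', hfc⟩ := (h.isTour T hT).exists_link hy 0
  refine h.not_colAdj hS hT hST he hl hf hl'.symm (hfc.trans hec.symm) ?_ ?_
  · exact (hxy _ _).2 ⟨f, hl', hfc.trans hec.symm⟩
  · exact ((hxy _ _).1 ⟨e, hl, rfl⟩).symm

lemma exists_colAdj [G.Loopless] (h : IsMinimalTourFactor G φ 𝒜 ℰ) (hG : MClosedUpToTwins G φ)
    (hS : S ∈ 𝒜) (hT : T ∈ 𝒜) (hST : S ≠ T) (hx : x ∈ S) (hy : y ∈ T) (hxz : ColAdj G φ c x z)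
    (hzy : ColAdj G φ c z y) : ∃ d, ColAdj G φ d x y :=
  (hG c x z y hxz hzy).resolve_left (h.not_twins hS hT hST hx hy)

lemma colAdj_rev [G.Loopless] (h : IsMinimalTourFactor G φ 𝒜 ℰ) (hG : MClosedUpToTwins G φ)
    (hS : S ∈ 𝒜) (hT : T ∈ 𝒜) (hST : S ≠ T) (he : e ∈ ℰ S) (hl : G.IsLink e x y) (hf : f ∈ ℰ T)
    (hl' : G.IsLink f v w) (hfe : φ f = φ e) (hxv : ColAdj G φ (φ e) x v)
    (hxw : ColAdj G φ (φ e) x w) : ColAdj G φ (φ e).rev y v := by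
  obtain ⟨d, hd⟩ := h.exists_colAdj hG hS hT hST ((h.isTour S hS).right_mem he hl)
    ((h.isTour T hT).left_mem hf hl') ⟨e, hl.symm, rfl⟩ hxv
  have hde : d ≠ φ e := by
    rintro rfl
    exact h.not_colAdj hS hT hST he hl hf hl'.symm hfe hxw hd
  rwa [← eq_rev_of_ne hde]

lemma exists_monoTo (h : IsMinimalTourFactor G φ 𝒜 ℰ) (hS : S ∈ 𝒜) (hT : T ∈ 𝒜) (hST : S ≠ T)
    (hx : x ∈ S) (hy : y ∈ T) (hxy : ColAdj G φ c x y) :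
    (∃ v ∈ S, ∃ d, MonoTo G φ T v d) ∨ ∃ v ∈ T, ∃ d, MonoTo G φ S v d := by
  by_contra! ⟨hmS, hmT⟩
  obtain ⟨W, Q, hW, hQ⟩ := exists_isTour_of_forall_not_monoTo (h.isTour S hS).finite
    (h.isTour T hT).finite (h.isTourFactor.pairwiseDisjoint hS hT hST) hmS hmT hx hy hxy
  obtain ⟨v, hv⟩ := hW.nonempty
  obtain ⟨e, he, -⟩ := hW.exists_link hv 0
  obtain ⟨a, ha, b, hb, hl⟩ := hQ e he
  refine hST (h.eq_of_isTour hW ?_ hS hT ha (hW.left_mem he hl) hb (hW.right_mem he hl))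
  intro f hf R hR
  obtain ⟨a, ha, b, hb, hl⟩ := hQ f hf
  exact h.notMem_edges hS hT hST ha hb hl hR

lemma colAdj_of_monoTo [G.Loopless] (h : IsMinimalTourFactor G φ 𝒜 ℰ)
    (hG : MClosedUpToTwins G φ) (hS : S ∈ 𝒜) (hT : T ∈ 𝒜) (hST : S ≠ T) (hx : x ∈ S) (hy : y ∈ T)
    (hm : MonoTo G φ T x c) (hxz : ColAdj G φ d x z) (hzy : ColAdj G φ d z y) :
    ColAdj G φ c x y := by
  obtain ⟨b, hb⟩ := h.exists_colAdj hG hS hT hST hx hy hxz hzy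
  exact hm.2 y hy b hb ▸ hb

lemma colAdj_rev_of_monoTo [G.Loopless] (h : IsMinimalTourFactor G φ 𝒜 ℰ)
    (hG : MClosedUpToTwins G φ) (hS : S ∈ 𝒜) (hT : T ∈ 𝒜) (hST : S ≠ T) (he : e ∈ ℰ S)
    (hl : G.IsLink e x y) (hm : MonoTo G φ T x (φ e)) (hv : v ∈ T)
    (hxv : ColAdj G φ (φ e) x v) : ColAdj G φ (φ e).rev y v := by
  obtain ⟨f, hf, w, hw, hl', hfe⟩ := (h.isTour T hT).exists_link hv (φ e)
  exact h.colAdj_rev hG hS hT hST he hl hf hl' hfe hxv <|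
    h.colAdj_of_monoTo hG hS hT hST ((h.isTour S hS).left_mem he hl) hw hm hxv ⟨f, hl', hfe⟩

lemma monoTo_rev [G.Loopless] (h : IsMinimalTourFactor G φ 𝒜 ℰ) (hG : MClosedUpToTwins G φ)
    (hS : S ∈ 𝒜) (hT : T ∈ 𝒜) (hST : S ≠ T) (he : e ∈ ℰ S) (hl : G.IsLink e x y)
    (hm : MonoTo G φ T x (φ e)) : MonoTo G φ T y (φ e).rev := by
  obtain ⟨v, hv, hxv⟩ := id hm.1
  refine ⟨⟨v, hv, h.colAdj_rev_of_monoTo hG hS hT hST he hl hm hv hxv⟩, fun w hw d hd => ?_⟩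
  refine eq_rev_of_ne ?_
  rintro rfl
  have hxw := h.colAdj_of_monoTo hG hS hT hST ((h.isTour S hS).left_mem he hl) hw hm
    ⟨e, hl, rfl⟩ hd
  exact rev_ne_self _ (h.colour_unique hS hT hST ((h.isTour S hS).right_mem he hl) hw
    (h.colAdj_rev_of_monoTo hG hS hT hST he hl hm hw hxw) hd)

lemma exists_monoTo_ssubset [G.Loopless] (h : IsMinimalTourFactor G φ 𝒜 ℰ)
    (hG : MClosedUpToTwins G φ) (hS : S ∈ 𝒜) (hT : T ∈ 𝒜) (hST : S ≠ T) (hx : x ∈ S)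
    (hm : MonoTo G φ T x c) (hfull : ¬ FullTo G φ T x c) :
    ∃ y ∈ S, MonoTo G φ T y c.rev ∧
      T ∩ {v | ColAdj G φ c x v} ⊂ T ∩ {v | ColAdj G φ c.rev y v} := by
  obtain ⟨e, he, y, hy, hl, rfl⟩ := (h.isTour S hS).exists_link hx c
  have hmy := h.monoTo_rev hG hS hT hST he hl hm
  have hrev {v} (hv : v ∈ T) := h.colAdj_rev_of_monoTo hG hS hT hST he hl hm hv
  obtain ⟨v₀, hv₀, hxv₀⟩ := id hm.1
  obtain ⟨w₀, hw₀, hxw₀⟩ : ∃ w ∈ T, ¬ ColAdj G φ (φ e) x w := by simpa [FullTo] using hfull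
  obtain ⟨f, hf, v, w, hvw, hv, hw⟩ := (h.isTour T hT).exists_boundary
    (N := {v | ColAdj G φ (φ e) x v}) hv₀ hxv₀ hw₀ hxw₀
  have hvT := (h.isTour T hT).left_mem hf hvw
  have hwT := (h.isTour T hT).right_mem hf hvw
  have hfe : φ f = (φ e).rev := eq_rev_of_ne fun hfe =>
    hw (h.colAdj_of_monoTo hG hS hT hST hx hwT hm hv ⟨f, hvw, hfe⟩)
  have hyw : ColAdj G φ (φ e).rev y w :=
    h.colAdj_of_monoTo hG hS hT hST hy hwT hmy (hrev hvT hv) ⟨f, hvw, hfe⟩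
  have hsub : T ∩ {v | ColAdj G φ (φ e) x v} ⊆ T ∩ {v | ColAdj G φ (φ e).rev y v} :=
    fun u hu => ⟨hu.1, hrev hu.1 hu.2⟩
  exact ⟨y, hy, hmy, (Set.ssubset_iff_of_subset hsub).2 ⟨w, ⟨hwT, hyw⟩, fun hw' => hw hw'.2⟩⟩

lemma exists_fullTo [G.Loopless] (h : IsMinimalTourFactor G φ 𝒜 ℰ) (hG : MClosedUpToTwins G φ)
    (hS : S ∈ 𝒜) (hT : T ∈ 𝒜) (hST : S ≠ T) (hx : x ∈ S) (hm : MonoTo G φ T x c) :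
    ∃ y ∈ S, ∃ d, FullTo G φ T y d := by
  let 𝒩 : Set (Set α) := {N | ∃ y ∈ S, ∃ d, MonoTo G φ T y d ∧ N = T ∩ {v | ColAdj G φ d y v}}
  have h𝒩 : 𝒩.Finite := (h.isTour T hT).finite.powerset.subset <| by
    rintro _ ⟨y, -, d, -, rfl⟩
    exact Set.inter_subset_left
  obtain ⟨_, ⟨y, hy, d, hyd, rfl⟩, hmax⟩ := h𝒩.exists_maximal ⟨_, x, hx, c, hm, rfl⟩
  refine ⟨y, hy, d, ?_⟩
  by_contra hfull
  obtain ⟨z, hz, hzd, hlt⟩ := h.exists_monoTo_ssubset hG hS hT hST hy hyd hfull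
  exact hlt.2 (hmax ⟨z, hz, _, hzd, rfl⟩ hlt.1)

/-! ### Domination -/

lemma fullTo_rev [G.Loopless] (h : IsMinimalTourFactor G φ 𝒜 ℰ) (hG : MClosedUpToTwins G φ)
    (hS : S ∈ 𝒜) (hT : T ∈ 𝒜) (hST : S ≠ T) (he : e ∈ ℰ S) (hl : G.IsLink e x y)
    (hx : FullTo G φ T x (φ e)) : FullTo G φ T y (φ e).rev := by
  intro v hv
  obtain ⟨f, hf, w, hw, hl', hfe⟩ := (h.isTour T hT).exists_link hv (φ e)
  exact h.colAdj_rev hG hS hT hST he hl hf hl' hfe (hx v hv) (hx w hw)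

lemma fullTo_unique (h : IsMinimalTourFactor G φ 𝒜 ℰ) (hS : S ∈ 𝒜) (hT : T ∈ 𝒜) (hST : S ≠ T)
    (hx : x ∈ S) (hc : FullTo G φ T x c) (hd : FullTo G φ T x d) : c = d := by
  obtain ⟨y, hy⟩ := (h.isTour T hT).nonempty
  exact h.colour_unique hS hT hST hx hy (hc y hy) (hd y hy)

lemma dominates_or_dominates [G.Loopless] (h : IsMinimalTourFactor G φ 𝒜 ℰ)
    (hG : MClosedUpToTwins G φ) (hS : S ∈ 𝒜) (hT : T ∈ 𝒜) (hST : S ≠ T) (hx : x ∈ S) (hy : y ∈ T)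
    (hxy : ColAdj G φ c x y) : Dominates G φ S T ∨ Dominates G φ T S := by
  have hdom {A B : Set α} (hA : A ∈ 𝒜) (hB : B ∈ 𝒜) (hAB : A ≠ B) {v} (hv : v ∈ A) {b}
      (hm : MonoTo G φ B v b) : Dominates G φ A B := by
    obtain ⟨w, hw, d, hd⟩ := h.exists_fullTo hG hA hB hAB hv hm
    exact fun u hu => (h.isTour A hA).invariant hw hd
      (fun e he v w hl => h.fullTo_rev hG hA hB hAB he hl) hu
  rcases h.exists_monoTo hS hT hST hx hy hxy with ⟨v, hv, b, hm⟩ | ⟨v, hv, b, hm⟩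
  exacts [Or.inl (hdom hS hT hST hv hm), Or.inr (hdom hT hS hST.symm hv hm)]

lemma fullTo_rev_of_fullTo [G.Loopless] (h : IsMinimalTourFactor G φ 𝒜 ℰ)
    (hG : MClosedUpToTwins G φ) (hS : S ∈ 𝒜) (hT : T ∈ 𝒜) (hST : S ≠ T) (he : e ∈ ℰ S)
    (hl : G.IsLink e x y) (hx : FullTo G φ T x c) : FullTo G φ T y c.rev :=
  (h.isTour S hS).invariant_isLink he hl hx fun _ he _ _ hl => h.fullTo_rev hG hS hT hST he hl

lemma exists_fullTo_of_dominates [G.Loopless] (h : IsMinimalTourFactor G φ 𝒜 ℰ)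
    (hG : MClosedUpToTwins G φ) (hS : S ∈ 𝒜) (hT : T ∈ 𝒜) (hST : S ≠ T)
    (hD : Dominates G φ S T) (c : Fin 2) : ∃ x ∈ S, FullTo G φ T x c := by
  obtain ⟨x, hx⟩ := (h.isTour S hS).nonempty
  obtain ⟨d, hd⟩ := hD x hx
  by_cases hdc : d = c
  · exact ⟨x, hx, hdc ▸ hd⟩
  · obtain ⟨e, he, y, hy, hl, -⟩ := (h.isTour S hS).exists_link hx 0
    rw [eq_rev_of_ne (Ne.symm hdc)]
    exact ⟨y, hy, h.fullTo_rev_of_fullTo hG hS hT hST he hl hd⟩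

lemma ne_of_dominates [G.Loopless] (h : IsMinimalTourFactor G φ 𝒜 ℰ) (hS : S ∈ 𝒜)
    (hD : Dominates G φ S T) : S ≠ T := by
  rintro rfl
  exact not_dominates_self (h.isTour S hS).nonempty hD

lemma not_dominates [G.Loopless] (h : IsMinimalTourFactor G φ 𝒜 ℰ) (hG : MClosedUpToTwins G φ)
    (hS : S ∈ 𝒜) (hT : T ∈ 𝒜) (hD : Dominates G φ S T) : ¬ Dominates G φ T S := by
  intro hD'
  have hST := h.ne_of_dominates hS hD
  obtain ⟨x, hx, hxc⟩ := h.exists_fullTo_of_dominates hG hS hT hST hD 0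
  obtain ⟨y, hy, hyc⟩ := h.exists_fullTo_of_dominates hG hT hS hST.symm hD' 1
  exact absurd (h.colour_unique hS hT hST hx hy (hxc y hy) (hyc x hx).symm) (by decide)

lemma exists_colAdj_of_dominates [G.Loopless] (h : IsMinimalTourFactor G φ 𝒜 ℰ)
    (hG : MClosedUpToTwins G φ) (hS : S ∈ 𝒜) (hT : T ∈ 𝒜) (hU : U ∈ 𝒜) (hSU : S ≠ U)
    (hD : Dominates G φ S T) (hy : y ∈ T) (hz : z ∈ U) (hyz : ColAdj G φ c y z) :
    ∃ x ∈ S, ∃ d, ColAdj G φ d x z := by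
  obtain ⟨x, hx, hxc⟩ := h.exists_fullTo_of_dominates hG hS hT (h.ne_of_dominates hS hD) hD c
  exact ⟨x, hx, h.exists_colAdj hG hS hU hSU hx hz (hxc y hy) hyz⟩

lemma colour_eq_of_fullTo [G.Loopless] (h : IsMinimalTourFactor G φ 𝒜 ℰ)
    (hG : MClosedUpToTwins G φ) (hS : S ∈ 𝒜) (hT : T ∈ 𝒜) (hST : S ≠ T) (hx : x ∈ S) (hy : y ∈ S)
    (hl : G.IsLink e x y) (hxc : FullTo G φ T x c) (hyc : FullTo G φ T y c) : φ e = c := by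
  by_contra hec
  have heR : ∀ R ∈ 𝒜, e ∉ ℰ R := by
    intro R hR heR
    obtain rfl := h.isTourFactor.eq_of_mem hS hR hx ((h.isTour R hR).left_mem heR hl)
    exact rev_ne_self c (h.fullTo_unique hS hT hST hy
      (h.fullTo_rev_of_fullTo hG hS hT hST heR hl hxc) hyc)
  obtain ⟨v, hv⟩ := (h.isTour T hT).nonempty
  obtain ⟨f, hf, w, hw, hl', rfl⟩ := (h.isTour T hT).exists_link hv c
  obtain ⟨g, hg, hgc⟩ := hxc v hv
  obtain ⟨k, hk, hkc⟩ := hyc w hw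
  have hgk : g ≠ k := by
    rintro rfl
    rcases hg.left_eq_or_eq hk with hxy | hxw
    exacts [hl.ne hxy, h.ne hS hT hST hx hw hxw]
  exact h.ne hS hT hST hx (h.mem_of_detour hT hf hl' hg.symm hl hk hgc (eq_rev_of_ne hec) hkc hgk
    fun R hR => ⟨h.notMem_edges hS hT hST hx hv hg hR, heR R hR,
      h.notMem_edges hS hT hST hy hw hk hR⟩) rfl

lemma not_dominates_of_dominates_of_dominates [G.Loopless] (h : IsMinimalTourFactor G φ 𝒜 ℰ)
    (hG : MClosedUpToTwins G φ) (hS : S ∈ 𝒜) (hT : T ∈ 𝒜) (hU : U ∈ 𝒜)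
    (hST : Dominates G φ S T) (hTU : Dominates G φ T U) : ¬ Dominates G φ U S := by
  intro hUS
  have hST' := h.ne_of_dominates hS hST
  have hTU' := h.ne_of_dominates hT hTU
  have hUS' := h.ne_of_dominates hU hUS
  obtain ⟨x, hx, hxc⟩ := h.exists_fullTo_of_dominates hG hS hT hST' hST 1
  obtain ⟨y, hy, hyc⟩ := h.exists_fullTo_of_dominates hG hT hU hTU' hTU 0
  obtain ⟨z, hz, hzc⟩ := h.exists_fullTo_of_dominates hG hU hS hUS' hUS 0
  obtain ⟨e, he, w, hw, hl, hec⟩ := (h.isTour U hU).exists_link hz 0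
  obtain ⟨f, hf, hfc⟩ := hyc w hw
  obtain ⟨g, hg, hgc⟩ := hxc y hy
  obtain ⟨k, hk, hkc⟩ := hzc x hx
  have hfk : f ≠ k := by
    rintro rfl
    rcases hf.left_eq_or_eq hk with hyz | hyx
    exacts [h.ne hT hU hTU' hy hz hyz, h.ne hS hT hST' hx hy hyx.symm]
  refine h.ne hT hU hTU' hy (h.mem_of_detour hU he hl.symm hf.symm hg.symm hk.symm
    (hfc.trans hec.symm) ?_ (hkc.trans hec.symm) hfk fun R hR =>
    ⟨h.notMem_edges hT hU hTU' hy hw hf hR, h.notMem_edges hS hT hST' hx hy hg hR,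
      h.notMem_edges hU hS hUS' hz hx hk hR⟩) rfl
  rw [hgc, hec]
  decide

lemma dominates_trans [G.Loopless] (h : IsMinimalTourFactor G φ 𝒜 ℰ) (hG : MClosedUpToTwins G φ)
    (hS : S ∈ 𝒜) (hT : T ∈ 𝒜) (hU : U ∈ 𝒜) (hST : Dominates G φ S T) (hTU : Dominates G φ T U) :
    Dominates G φ S U := by
  have hSU : S ≠ U := by
    rintro rfl
    exact h.not_dominates hG hS hT hST hTU
  obtain ⟨y, hy⟩ := (h.isTour T hT).nonempty
  obtain ⟨z, hz⟩ := (h.isTour U hU).nonempty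
  obtain ⟨c, hyc⟩ := hTU y hy
  obtain ⟨x, hx, d, hxz⟩ := h.exists_colAdj_of_dominates hG hS hT hU hSU hST hy hz (hyc z hz)
  exact (h.dominates_or_dominates hG hS hU hSU hx hz hxz).resolve_right
    (h.not_dominates_of_dominates_of_dominates hG hS hT hU hST hTU)

/-- If `x` were joined to `T` and `U` by edges of different colours, then these edges and the ones
from a successor of `x` would contain an alternating `4`-cycle that meets all three tours. -/
lemma fullTo_of_fullTo [G.Loopless] (h : IsMinimalTourFactor G φ 𝒜 ℰ)
    (hG : MClosedUpToTwins G φ) (hS : S ∈ 𝒜) (hT : T ∈ 𝒜) (hU : U ∈ 𝒜) (hST : S ≠ T)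
    (hSU : Dominates G φ S U) (hx : x ∈ S) (hxT : FullTo G φ T x c) : FullTo G φ U x c := by
  have hSU' := h.ne_of_dominates hS hSU
  obtain ⟨d, hxU⟩ := hSU x hx
  by_cases hdc : d = c
  · exact hdc ▸ hxU
  obtain rfl := eq_rev_of_ne hdc
  obtain ⟨e, he, x', hx', hl, -⟩ := (h.isTour S hS).exists_link hx 0
  have hx'T := h.fullTo_rev_of_fullTo hG hS hT hST he hl hxT
  have hx'U := h.fullTo_rev_of_fullTo hG hS hU hSU' he hl hxU
  rw [Fin.rev_rev] at hx'U
  have hTU : T ≠ U := by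
    rintro rfl
    exact rev_ne_self c (h.fullTo_unique hS hT hST hx hxU hxT)
  obtain ⟨y, hy⟩ := (h.isTour T hT).nonempty
  obtain ⟨z, hz⟩ := (h.isTour U hU).nonempty
  obtain ⟨i, hi, hic⟩ := hxT y hy
  obtain ⟨j, hj, hjc⟩ := hx'T y hy
  obtain ⟨k, hk, hkc⟩ := hx'U z hz
  obtain ⟨l, hll, hlc⟩ := hxU z hz
  have hik : i ≠ k := by
    rintro rfl
    rcases hi.right_eq_or_eq hk with hyx' | hyz
    exacts [h.ne hS hT hST hx' hy hyx'.symm, h.ne hT hU hTU hy hz hyz]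
  have hjl : j ≠ l := by
    rintro rfl
    rcases hj.right_eq_or_eq hll with hyx | hyz
    exacts [h.ne hS hT hST hx hy hyx.symm, h.ne hT hU hTU hy hz hyz]
  have hW := isTour_four_cycle hi hj.symm hk hll.symm hic hjc hkc hlc hik hjl
  refine absurd (h.eq_of_isTour hW ?_ hS hT hx (by simp) hy (by simp)) hST
  rintro _ (rfl | rfl | rfl | rfl) R hR
  exacts [h.notMem_edges hS hT hST hx hy hi hR, h.notMem_edges hS hT hST hx' hy hj hR,
    h.notMem_edges hS hU hSU' hx' hz hk hR, h.notMem_edges hS hU hSU' hx hz hll hR]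

lemma exists_forall_not_dominates [G.Loopless] (h : IsMinimalTourFactor G φ 𝒜 ℰ)
    (hG : MClosedUpToTwins G φ) (hne : 𝒜.Nonempty) :
    ∃ S ∈ 𝒜, ∀ T ∈ 𝒜, ¬ Dominates G φ T S := by
  let r (S T : 𝒜) : Prop := Dominates G φ (S : Set α) T
  have : IsTrans 𝒜 r := ⟨fun S T U => h.dominates_trans hG S.2 T.2 U.2⟩
  have : Std.Irrefl r := ⟨fun S => not_dominates_self (h.isTour S S.2).nonempty⟩
  have := hne.to_subtype
  obtain ⟨S, -, hS⟩ := (Finite.wellFounded_of_trans_of_irrefl r).has_min Set.univ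
    Set.univ_nonempty
  exact ⟨S, S.2, fun T hT => hS ⟨T, hT⟩ trivial⟩

lemma exists_forall_dominates [G.Loopless] (h : IsMinimalTourFactor G φ 𝒜 ℰ)
    (hG : MClosedUpToTwins G φ) (hconn : AltWalkConnected G φ) (hne : 𝒜.Nonempty) :
    ∃ S ∈ 𝒜, ∀ T ∈ 𝒜, T = S ∨ Dominates G φ S T := by
  obtain ⟨S, hS, hmin⟩ := h.exists_forall_not_dominates hG hne
  have hadj {T} (hT : T ∈ 𝒜) (hST : S ≠ T) {x y c} (hx : x ∈ S) (hy : y ∈ T)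
      (hxy : ColAdj G φ c x y) : Dominates G φ S T :=
    (h.dominates_or_dominates hG hS hT hST hx hy hxy).resolve_right (hmin T hT)
  refine ⟨S, hS, fun T hT => or_iff_not_imp_left.2 fun hTS => ?_⟩
  obtain ⟨u, hu⟩ := (h.isTour S hS).nonempty
  obtain ⟨v, hv⟩ := (h.isTour T hT).nonempty
  obtain ⟨p, d, hp⟩ := hconn u ((h.isTour S hS).subset_vertexSet hu) v
    ((h.isTour T hT).subset_vertexSet hv) (h.ne hS hT (Ne.symm hTS) hu hv) 0
  refine (hp.invariant (P := fun x _ => ∀ R ∈ 𝒜, x ∈ R → R = S ∨ Dominates G φ S R)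
    (fun R hR huR => Or.inl (h.isTourFactor.eq_of_mem hR hS huR hu)) ?_ T hT hv).resolve_left hTS
  rintro e - x y hl hx B hB hyB
  refine or_iff_not_imp_left.2 fun hBS => ?_
  obtain ⟨A, hA, hxA⟩ := h.isTourFactor.exists_mem hl.left_mem
  rcases hx A hA hxA with rfl | hSA
  · exact hadj hB (Ne.symm hBS) hxA hyB ⟨e, hl, rfl⟩
  · obtain ⟨w, hw, d, hwy⟩ := h.exists_colAdj_of_dominates hG hS hA hB (Ne.symm hBS) hSA hxA hyB
      ⟨e, hl, rfl⟩
    exact hadj hB (Ne.symm hBS) hw hyB hwy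

lemma mem_of_altWalk_rev [G.Loopless] (h : IsMinimalTourFactor G φ 𝒜 ℰ)
    (hG : MClosedUpToTwins G φ) (hS : S ∈ 𝒜) (hD : ∀ U ∈ 𝒜, U = S ∨ Dominates G φ S U)
    (hT : T ∈ 𝒜) (hST : S ≠ T) {u : α} (hu : u ∈ S) (huc : FullTo G φ T u c)
    {p : List (β × α)} (hp : AltWalk G φ u c.rev p v d) : v ∈ S := by
  suffices hP : v ∈ S ∧ FullTo G φ T v d.rev from hP.1
  refine hp.invariant (P := fun x b => x ∈ S ∧ FullTo G φ T x b.rev)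
    ⟨hu, by rwa [Fin.rev_rev]⟩ ?_
  rintro e - x y hl ⟨hx, hxT⟩
  have hy : y ∈ S := by
    obtain ⟨U, hU, hyU⟩ := h.isTourFactor.exists_mem hl.right_mem
    rcases hD U hU with rfl | hSU
    · exact hyU
    · have hxU := h.fullTo_of_fullTo hG hS hT hU hST hSU hx hxT
      exact absurd (h.colour_unique hS hU (h.ne_of_dominates hS hSU) hx hyU (hxU y hyU)
        ⟨e, hl, rfl⟩) (rev_ne_self _)
  obtain ⟨b, hb⟩ := (hD T hT).resolve_left hST.symm y hy
  refine ⟨hy, ?_⟩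
  rcases eq_or_ne b (φ e) with rfl | hbe
  · rwa [Fin.rev_rev]
  · rw [eq_rev_of_ne hbe] at hb
    exact absurd (h.colour_eq_of_fullTo hG hS hT hST hx hy hl hxT hb) (rev_ne_self _).symm

lemma exists_eq_singleton [G.Loopless] (h : IsMinimalTourFactor G φ 𝒜 ℰ)
    (hG : MClosedUpToTwins G φ) (hconn : AltWalkConnected G φ) (hne : 𝒜.Nonempty) :
    ∃ S, 𝒜 = {S} := by
  obtain ⟨S, hS, hD⟩ := h.exists_forall_dominates hG hconn hne
  refine ⟨S, Finset.eq_singleton_iff_unique_mem.2 ⟨hS, fun T hT => ?_⟩⟩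
  by_contra hTS
  have hST := Ne.symm hTS
  obtain ⟨u, hu⟩ := (h.isTour S hS).nonempty
  obtain ⟨v, hv⟩ := (h.isTour T hT).nonempty
  obtain ⟨c, hc⟩ := (hD T hT).resolve_left hTS u hu
  obtain ⟨p, d, hp⟩ := hconn u ((h.isTour S hS).subset_vertexSet hu) v
    ((h.isTour T hT).subset_vertexSet hv) (h.ne hS hT hST hu hv) c.rev
  exact h.ne hS hT hST (h.mem_of_altWalk_rev hG hS hD hT hST hu hc hp) hv rfl

end IsMinimalTourFactor

end TwoEdgeColoured

theorem mainTheorem8_general {α β : Type*} {G : Graph α β} {φ : β → Fin 2} [G.Loopless]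
    (hclosed : TwoEdgeColoured.MClosedUpToTwins G φ) (hne : G.vertexSet.Nonempty)
    (hconn : TwoEdgeColoured.AltWalkConnected G φ)
    (hfactor : TwoEdgeColoured.HasEulerianFactor G φ) :
    TwoEdgeColoured.Supereulerian G φ := by
  obtain ⟨ℬ, hℬ⟩ := hfactor.exists_isTourFactor
  obtain ⟨𝒜, ℰ, h⟩ := hℬ.exists_isMinimalTourFactor
  obtain ⟨v, hv⟩ := hne
  obtain ⟨T, hT, -⟩ := h.isTourFactor.exists_mem hv
  obtain ⟨S, rfl⟩ := h.exists_eq_singleton hclosed hconn ⟨T, hT⟩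
  have hSV : S = G.vertexSet := by simpa using h.isTourFactor.sUnion_eq
  exact TwoEdgeColoured.supereulerian_iff.2 ⟨ℰ S, hSV ▸ h.isTour S (by simp)⟩

theorem mainTheorem8 {α β γ δ : Type*}
    (M : Graph γ δ) (ψ : δ → Fin 2) (hM : M.Loopless) (hclosed : TwoEdgeColoured.MClosed M ψ)
    (G : Graph α β) (φ : β → Fin 2) (hext : TwoEdgeColoured.IsExtension M ψ G φ)
    (hconn : TwoEdgeColoured.ColourConnected G φ)
    (hfactor : TwoEdgeColoured.HasEulerianFactor G φ) :
    TwoEdgeColoured.Supereulerian G φ := by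
  have := hext.loopless
  exact mainTheorem8_general (hext.mClosedUpToTwins hclosed) hext.vertexSet_nonempty
    hconn.altWalkConnected hfactor
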